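/- Let $k\ge 1$ and identify $\mathcal M_k\otimes\mathcal M_k$ ($\mathcal M_k$ being the complex $k\times k$ matrices) with $\mathcal M_{k^2}$ through the Kronecker product. Let the partial transpose $\gamma\mapsto\gamma^{\Gamma}$, the realignment $\mathcal R$ and the reduction $\gamma\mapsto\gamma_A$ be the linear maps on $\mathcal M_k\otimes\mathcal M_k$ with $(C\otimes D)^{\Gamma}=C\otimes D^t$, $\mathcal R(ab^t\otimes cd^t)=ac^t\otimes bd^t$ and $(C\otimes D)_A=\operatorname{tr}(D)\,C$, for $C,D\in\mathcal M_k$ and $a,b,c,d\in\mathbb C^k$. A positive semidefinite $\gamma$ is called SPC if $\mathcal R(\gamma^{\Gamma})$ is positive semidefinite, and invariant under realignment if $\mathcal R(\gamma)=\gamma$. Let $\gamma\in\mathcal M_k\otimes\mathcal M_k$ be a positive semidefinite Hermitian matrix with $\operatorname{rank}(\gamma_A)=k$. There is an invertible matrix $R\in\mathcal M_k$ such that 1. if $\mathcal R(\gamma^{\Gamma})$ is positive semidefinite (i.e. $\gamma$ is SPC), then $(R^*\otimes R^*)\gamma(R\otimes R)=\sum_{i=1}^n\lambda_i\,\gamma_i\otimes\gamma_i$,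 and this matrix is again SPC; 2. if $\mathcal R(\gamma)$ is positive semidefinite (in particular, if $\gamma$ is invariant under realignment), then $(R^*\otimes R^t)\gamma(R\otimes\overline R)=\sum_{i=1}^n\lambda_i\,\gamma_i\otimes\overline{\gamma_i}$, this matrix and its image under $\mathcal R$ are again positive semidefinite, and it is invariant under realignment if $\gamma$ is; where, in each case, $n\ge 1$ and a) $\lambda_1=\frac1k$ and $\gamma_1=\frac{\mathrm{Id}}{\sqrt k}$; b) $\frac1k\ge\lambda_i>0$ and $\gamma_i=\gamma_i^*$ for every $i$; c) $\operatorname{tr}(\gamma_i\gamma_j)=0$ for $i\ne j$ and $\operatorname{tr}(\gamma_i^2)=1$ for every $i$. -/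

import Mathlib

open scoped Matrix Kronecker ComplexOrder

/-- `M_k ⊗ M_k`, identified through the Kronecker product with the complex matrices whose rows and
columns are indexed by `{1,…,k} × {1,…,k}`. -/
abbrev BipartiteMatrix (k : ℕ) : Type := Matrix (Fin k × Fin k) (Fin k × Fin k) ℂ

namespace BipartiteMatrix

variable {k : ℕ}

/-- The partial transpose `γ^Γ`: transposition of the second tensor factor. -/
def partialTranspose (γ : BipartiteMatrix k) : BipartiteMatrix k :=
  Matrix.of fun p q => γ (p.1, q.2) (q.1, p.2)

theorem partialTranspose_kronecker (C D : Matrix (Fin k) (Fin k) ℂ) :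
    partialTranspose (C ⊗ₖ D) = C ⊗ₖ Dᵀ := rfl

/-- The realignment map `𝓡`, given by `𝓡(a bᵗ ⊗ c dᵗ) = a cᵗ ⊗ b dᵗ`
(see `realignment_kronecker`). -/
def realignment (γ : BipartiteMatrix k) : BipartiteMatrix k :=
  Matrix.of fun p q => γ (p.1, q.1) (p.2, q.2)

theorem realignment_kronecker (a b c d : Fin k → ℂ) :
    realignment (Matrix.vecMulVec a b ⊗ₖ Matrix.vecMulVec c d) =
      Matrix.vecMulVec a c ⊗ₖ Matrix.vecMulVec b d := by
  ext p q
  simp only [realignment, Matrix.of_apply, Matrix.kroneckerMap_apply, Matrix.vecMulVec_apply]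
  ring

/-- The reduced matrix `γ_A`: if `γ = ∑ C_i ⊗ D_i` then `γ_A = ∑ tr(D_i) C_i`. -/
def reducedA (γ : BipartiteMatrix k) : Matrix (Fin k) (Fin k) ℂ :=
  Matrix.of fun i j => ∑ m, γ (i, m) (j, m)

theorem reducedA_kronecker (C D : Matrix (Fin k) (Fin k) ℂ) :
    reducedA (C ⊗ₖ D) = D.trace • C := by
  ext i j
  simp [reducedA, Matrix.trace, Matrix.kroneckerMap_apply, Finset.mul_sum, mul_comm]

/-- Symmetric with positive coefficients: `γ ≥ 0` and `𝓡(γ^Γ) ≥ 0`. -/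
def IsSPC (γ : BipartiteMatrix k) : Prop :=
  γ.PosSemidef ∧ (realignment (partialTranspose γ)).PosSemidef

/-- Invariant under realignment: `γ ≥ 0` and `𝓡(γ) = γ`. -/
def IsRealignmentInvariant (γ : BipartiteMatrix k) : Prop :=
  γ.PosSemidef ∧ realignment γ = γ

end BipartiteMatrix

/-- The entrywise complex conjugate of a matrix. -/
def Matrix.entrywiseConj {k : ℕ} (X : Matrix (Fin k) (Fin k) ℂ) : Matrix (Fin k) (Fin k) ℂ :=
  X.map star

/-- Coefficients `lam` and matrices `g` as in a filter normal form; index `0` here is the index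
`1` of the usual notation `∑_{i=1}^n`. -/
structure IsFilterFamily {k n : ℕ} (lam : Fin (n + 1) → ℝ)
    (g : Fin (n + 1) → Matrix (Fin k) (Fin k) ℂ) : Prop where
  lam_zero : lam 0 = 1 / (k : ℝ)
  g_zero : g 0 = ((1 / √(k : ℝ) : ℝ) : ℂ) • (1 : Matrix (Fin k) (Fin k) ℂ)
  lam_pos : ∀ i, 0 < lam i
  lam_le : ∀ i, lam i ≤ 1 / (k : ℝ)
  isHermitian : ∀ i, (g i).IsHermitian
  trace_mul_of_ne : ∀ i j, i ≠ j → (g i * g j).trace = 0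
  trace_sq : ∀ i, (g i ^ 2).trace = 1

/-! ### Superoperators on `M_k` and their congruences -/

open Matrix
namespace BipartiteMatrix
variable {k : ℕ}

/-! Let `S` be `𝓡(γ)` or `𝓡(γ^Γ)`, assumed positive semidefinite. Through `act` it becomes a linear
map on `M_k` with two kinds of positivity: it is a positive semidefinite operator for the trace
inner product because `S ≥ 0`, and it maps positive matrices to positive matrices because `γ ≥ 0`.
Its value at the identity is `γ_A`, which the rank condition makes positive definite.

Scaling (`exists_congr_act_one`): maximize `|det R|` subject to `tr (P S(P)) ≤ 1`, where `P = R Rᴴ`.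
The maximum exists by compactness, and its first-order condition says that the congruent map sends
the identity to `(1/k)` times itself.

Decomposition (`exists_filterFamily`): since `γ` is Hermitian, so is `𝓡(S)`, and `S` therefore
commutes with the conjugate transpose on `M_k`. Hence it has an orthonormal eigenbasis of Hermitian
matrices. One eigenvector can be chosen as the normalized identity, with eigenvalue `1/k`, and
positivity of the map bounds every eigenvalue by `1/k`. Realigning the spectral decomposition of `S`
gives the tensor sum; in the SPC case a further partial transpose turns the conjugated second factor
into `γ_i`.

One `R` serves both cases: if both realignments are positive, then `γ^Γ = γ`
(`partialTranspose_eq_self`). -/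

/-- The linear map on `M_k` whose matrix, in row-major coordinates, is `S`. -/
def act (S : BipartiteMatrix k) :
    Matrix (Fin k) (Fin k) ℂ →ₗ[ℂ] Matrix (Fin k) (Fin k) ℂ where
  toFun X := Matrix.of fun i j => (S *ᵥ Matrix.vec Xᵀ) (i, j)
  map_add' X Y := by
    ext i j
    simp [Matrix.mulVec_add]
  map_smul' c X := by
    ext i j
    simp [Matrix.mulVec_smul]

theorem act_apply (S : BipartiteMatrix k) (X : Matrix (Fin k) (Fin k) ℂ) (i j : Fin k) :
    act S X i j = ∑ a, ∑ b, S (i, j) (a, b) * X a b := by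
  simp [act, Matrix.mulVec, dotProduct, Fintype.sum_prod_type, Matrix.vec]

theorem vec_transpose_act (S : BipartiteMatrix k) (X : Matrix (Fin k) (Fin k) ℂ) :
    Matrix.vec (act S X)ᵀ = S *ᵥ Matrix.vec Xᵀ := rfl

theorem trace_conjTranspose_mul (X Y : Matrix (Fin k) (Fin k) ℂ) :
    (Xᴴ * Y).trace = star (Matrix.vec Xᵀ) ⬝ᵥ Matrix.vec Yᵀ := by
  simp only [Matrix.trace, Matrix.diag, Matrix.mul_apply, dotProduct, Fintype.sum_prod_type,
    Matrix.vec, Matrix.conjTranspose_apply, Matrix.transpose_apply, Pi.star_apply]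
  exact Finset.sum_comm

theorem trace_mul_act_nonneg {S : BipartiteMatrix k} (hS : S.PosSemidef)
    (X : Matrix (Fin k) (Fin k) ℂ) : 0 ≤ (Xᴴ * act S X).trace := by
  rw [trace_conjTranspose_mul, vec_transpose_act]
  exact hS.dotProduct_mulVec_nonneg _

theorem trace_mul_act_comm {S : BipartiteMatrix k} (hS : S.IsHermitian)
    (X Y : Matrix (Fin k) (Fin k) ℂ) :
    (Xᴴ * act S Y).trace = star (Yᴴ * act S X).trace := by
  rw [trace_conjTranspose_mul, vec_transpose_act, trace_conjTranspose_mul, vec_transpose_act,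
    ← Matrix.star_dotProduct_star, star_star, Matrix.star_mulVec, hS.eq, dotProduct_comm,
    ← Matrix.dotProduct_mulVec, dotProduct_comm]

/-- The congruence `S ↦ (Rᴴ ⊗ Rᵗ) S (R ⊗ R̄)`. -/
def congr (R : Matrix (Fin k) (Fin k) ℂ) (S : BipartiteMatrix k) : BipartiteMatrix k :=
  (Rᴴ ⊗ₖ Rᵀ) * S * (R ⊗ₖ R.entrywiseConj)

theorem conjTranspose_entrywiseConj (R : Matrix (Fin k) (Fin k) ℂ) :
    R.entrywiseConjᴴ = Rᵀ := by
  ext i j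
  simp [Matrix.entrywiseConj]

theorem act_congr (R : Matrix (Fin k) (Fin k) ℂ) (S : BipartiteMatrix k)
    (X : Matrix (Fin k) (Fin k) ℂ) : act (congr R S) X = Rᴴ * act S (R * X * Rᴴ) * R := by
  apply Matrix.transpose_injective
  apply Matrix.vec_bijective.injective
  rw [vec_transpose_act, congr, ← Matrix.mulVec_mulVec, ← Matrix.mulVec_mulVec,
    Matrix.kronecker_mulVec_vec]
  have : R.entrywiseConj * Xᵀ * Rᵀ = (R * X * Rᴴ)ᵀ := by
    simp only [Matrix.transpose_mul, Matrix.mul_assoc]; rfl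
  rw [this, ← vec_transpose_act, Matrix.kronecker_mulVec_vec]
  simp only [Matrix.transpose_mul, Matrix.mul_assoc]

theorem posSemidef_congr {S : BipartiteMatrix k} (hS : S.PosSemidef)
    (R : Matrix (Fin k) (Fin k) ℂ) : (congr R S).PosSemidef := by
  have h := hS.conjTranspose_mul_mul_same (R ⊗ₖ R.entrywiseConj)
  rwa [Matrix.conjTranspose_kronecker, conjTranspose_entrywiseConj] at h

theorem kronecker_mul_mul_kronecker_apply (A B C D : Matrix (Fin k) (Fin k) ℂ)
    (γ : BipartiteMatrix k) (i j a b : Fin k) :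
    ((A ⊗ₖ B) * γ * (C ⊗ₖ D)) (i, j) (a, b) =
      ∑ m, ∑ n, ∑ s, ∑ t, A i m * B j n * γ (m, n) (s, t) * (C s a * D t b) := by
  rw [Matrix.mul_assoc]
  simp only [Matrix.mul_apply, Matrix.kroneckerMap_apply, Fintype.sum_prod_type, Finset.mul_sum,
    mul_assoc]

theorem realignment_kronecker_mul_mul_kronecker (A B C D : Matrix (Fin k) (Fin k) ℂ)
    (γ : BipartiteMatrix k) :
    realignment ((A ⊗ₖ B) * γ * (C ⊗ₖ D)) = (A ⊗ₖ Cᵀ) * realignment γ * (Bᵀ ⊗ₖ D) := by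
  ext ⟨i, j⟩ ⟨a, b⟩
  simp only [realignment, Matrix.of_apply, kronecker_mul_mul_kronecker_apply,
    Matrix.transpose_apply]
  refine Finset.sum_congr rfl fun m _ => ?_
  rw [Finset.sum_comm]
  refine Finset.sum_congr rfl fun n _ => Finset.sum_congr rfl fun s _ =>
    Finset.sum_congr rfl fun t _ => ?_
  ring

theorem partialTranspose_kronecker_mul_mul_kronecker (A B C D : Matrix (Fin k) (Fin k) ℂ)
    (γ : BipartiteMatrix k) :
    partialTranspose ((A ⊗ₖ B) * γ * (C ⊗ₖ D)) =
      (A ⊗ₖ Dᵀ) * partialTranspose γ * (C ⊗ₖ Bᵀ) := by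
  ext ⟨i, j⟩ ⟨a, b⟩
  simp only [partialTranspose, Matrix.of_apply, kronecker_mul_mul_kronecker_apply,
    Matrix.transpose_apply]
  refine Finset.sum_congr rfl fun m _ => ?_
  rw [Finset.sum_comm]
  conv_rhs => rw [Finset.sum_comm]
  refine Finset.sum_congr rfl fun s _ => ?_
  rw [Finset.sum_comm]
  refine Finset.sum_congr rfl fun n _ => Finset.sum_congr rfl fun t _ => ?_
  ring

theorem partialTranspose_partialTranspose (γ : BipartiteMatrix k) :
    partialTranspose (partialTranspose γ) = γ := rfl

/-- Realignment exchanges the two inner factors up to a transpose; the factors `Rᵗ` and `R` of this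
congruence are fixed by that exchange. -/
theorem realignment_congr (R : Matrix (Fin k) (Fin k) ℂ) (γ : BipartiteMatrix k) :
    realignment (congr R γ) = congr R (realignment γ) :=
  realignment_kronecker_mul_mul_kronecker _ _ _ _ _

theorem partialTranspose_kronecker_self_mul_mul_kronecker_self (R : Matrix (Fin k) (Fin k) ℂ)
    (γ : BipartiteMatrix k) :
    partialTranspose ((Rᴴ ⊗ₖ Rᴴ) * γ * (R ⊗ₖ R)) = congr R (partialTranspose γ) :=
  partialTranspose_kronecker_mul_mul_kronecker _ _ _ _ _

end BipartiteMatrix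

/-! ### A first-order inequality and two facts on Hermitian matrices -/

/-- Both sides equal `1` at `t = 0`, so their derivatives there, `2s` and `2kq`, are ordered. This
becomes the first-order condition at the maximizer. -/
theorem le_mul_of_forall_sq_le_pow {s q r : ℝ} {k : ℕ}
    (h : ∀ t : ℝ, 0 < t → (1 + t * s) ^ 2 ≤ (1 + 2 * t * q + t ^ 2 * r) ^ k) : s ≤ k * q := by
  have h1 : HasDerivAt (fun t : ℝ => 1 + 2 * t * q + t ^ 2 * r) (2 * q) 0 := by
    have := (((hasDerivAt_id (0 : ℝ)).const_mul 2).mul_const q).const_add 1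
    have h2 := ((hasDerivAt_pow 2 (0 : ℝ)).mul_const r)
    have h3 := this.add h2
    simp only [id, mul_one, Nat.cast_ofNat, Nat.add_one_sub_one, pow_one, mul_zero, zero_mul,
      add_zero] at h3
    exact h3
  have h2 : HasDerivAt (fun t : ℝ => 1 + t * s) s 0 := by
    simpa using ((hasDerivAt_id (0 : ℝ)).mul_const s).const_add 1
  have h3 := (h1.pow k).sub (h2.pow 2)
  have h4 := h3.hasDerivWithinAt (s := Set.Ioi 0)
  rw [hasDerivWithinAt_iff_tendsto_slope' (by simp)] at h4
  have h5 := ge_of_tendsto (b := 0) h4 (by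
    filter_upwards [self_mem_nhdsWithin] with t ht
    have ht : 0 < t := ht
    simp only [slope_def_field, Pi.sub_apply, Pi.pow_apply]
    refine div_nonneg ?_ (by linarith)
    have := h t ht
    simp
    linarith)
  simp at h5
  linarith

theorem Matrix.IsHermitian.exists_posSemidef_sub_smul {k : ℕ} (hk : 0 < k)
    {X : Matrix (Fin k) (Fin k) ℂ} (hX : X.IsHermitian) :
    ∃ (c : ℝ) (v : Fin k → ℂ), v ≠ 0 ∧ X *ᵥ v = (c : ℂ) • v ∧
      (X - (c : ℂ) • (1 : Matrix (Fin k) (Fin k) ℂ)).PosSemidef := by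
  have : Nonempty (Fin k) := ⟨⟨0, hk⟩⟩
  obtain ⟨i, hi⟩ := Finite.exists_min hX.eigenvalues
  refine ⟨hX.eigenvalues i, hX.eigenvectorBasis i, ?_, ?_, ?_⟩
  · intro h
    have := hX.eigenvectorBasis.orthonormal.ne_zero i
    exact this (by ext j; simpa using congrFun h j)
  · have := hX.mulVec_eigenvectorBasis i
    rw [this]
    ext j; simp
  · have h1 : X = (hX.eigenvectorUnitary : Matrix (Fin k) (Fin k) ℂ) *
        diagonal (RCLike.ofReal ∘ hX.eigenvalues) * star (hX.eigenvectorUnitary : Matrix _ _ ℂ) := by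
      conv_lhs => rw [hX.spectral_theorem, Unitary.conjStarAlgAut_apply]
    have h2 : (1 : Matrix (Fin k) (Fin k) ℂ) = (hX.eigenvectorUnitary : Matrix (Fin k) (Fin k) ℂ) *
        1 * star (hX.eigenvectorUnitary : Matrix _ _ ℂ) := by
      simp
    have h3 : X - (hX.eigenvalues i : ℂ) • (1 : Matrix (Fin k) (Fin k) ℂ) =
        (hX.eigenvectorUnitary : Matrix (Fin k) (Fin k) ℂ) *
        (diagonal fun j => ((hX.eigenvalues j - hX.eigenvalues i : ℝ) : ℂ)) *
          (hX.eigenvectorUnitary : Matrix (Fin k) (Fin k) ℂ)ᴴ := by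
      have h4 : (diagonal fun j => ((hX.eigenvalues j - hX.eigenvalues i : ℝ) : ℂ)) =
        diagonal (RCLike.ofReal ∘ hX.eigenvalues) - (hX.eigenvalues i : ℂ) • 1 := by
        rw [← diagonal_one, ← diagonal_smul, diagonal_sub]
        congr 1
        ext j
        simp
      rw [h4, Matrix.mul_sub, Matrix.sub_mul, Matrix.mul_smul, Matrix.smul_mul]
      conv_lhs => rw [h2]; arg 1; rw [h1]
      rfl
    rw [h3]
    refine PosSemidef.mul_mul_conjTranspose_same (PosSemidef.diagonal fun j => ?_) _
    simpa using hi j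

open scoped MatrixOrder Matrix.Norms.L2Operator in
theorem Matrix.PosSemidef.exists_eq_conjTranspose_mul_self {n : Type*} [Fintype n] [DecidableEq n]
    {A : Matrix n n ℂ} (hA : A.PosSemidef) : ∃ B : Matrix n n ℂ, A = Bᴴ * B :=
  CStarAlgebra.nonneg_iff_eq_star_mul_self.mp hA.nonneg

/-! ### Scaling by determinant maximization -/

namespace BipartiteMatrix
variable {k : ℕ}

theorem congr_congr (W R : Matrix (Fin k) (Fin k) ℂ) (S : BipartiteMatrix k) :
    congr W (congr R S) = congr (R * W) S := by
  have h : (R * W).entrywiseConj = R.entrywiseConj * W.entrywiseConj :=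
    Matrix.map_mul (f := starRingEnd ℂ)
  simp only [congr, h, Matrix.conjTranspose_mul, Matrix.transpose_mul, Matrix.mul_kronecker_mul,
    Matrix.mul_assoc]

/-- The value `tr (P * act S P)` at `P = R * Rᴴ`. -/
noncomputable def energy (S : BipartiteMatrix k) (R : Matrix (Fin k) (Fin k) ℂ) : ℝ :=
  (R * Rᴴ * act S (R * Rᴴ)).trace.re

theorem trace_act_congr_one (S : BipartiteMatrix k) (R : Matrix (Fin k) (Fin k) ℂ) :
    (act (congr R S) 1).trace = (R * Rᴴ * act S (R * Rᴴ)).trace := by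
  rw [act_congr, Matrix.mul_one, Matrix.trace_mul_comm, Matrix.mul_assoc]

theorem energy_congr (S : BipartiteMatrix k) (R W : Matrix (Fin k) (Fin k) ℂ) :
    energy (congr R S) W = energy S (R * W) := by
  simp only [energy, ← trace_act_congr_one, congr_congr]

theorem energy_smul (S : BipartiteMatrix k) (R : Matrix (Fin k) (Fin k) ℂ) (c : ℝ) :
    energy S ((c : ℂ) • R) = c ^ 4 * energy S R := by
  simp only [energy, Matrix.conjTranspose_smul, Matrix.smul_mul, Matrix.mul_smul, smul_smul,
    map_smul, Matrix.trace_smul]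
  simp only [RCLike.star_def, Complex.conj_ofReal, smul_eq_mul, ← Complex.ofReal_mul,
    Complex.re_ofReal_mul]
  ring

theorem energy_nonneg {S : BipartiteMatrix k} (hS : S.PosSemidef)
    (R : Matrix (Fin k) (Fin k) ℂ) : 0 ≤ energy S R := by
  have h := trace_mul_act_nonneg hS (R * Rᴴ)
  rw [Matrix.conjTranspose_mul, Matrix.conjTranspose_conjTranspose] at h
  exact (Complex.le_def.1 h).1

theorem continuous_energy (S : BipartiteMatrix k) : Continuous (energy S) := by
  have h : Continuous (act S) := LinearMap.continuous_of_finiteDimensional _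
  unfold energy
  fun_prop

/-- With `P = R Rᴴ`, expanding `0 ≤ ⟨1 - P, S(1 - P)⟩` bounds `2 tr (P S(1))` by `tr S(1) + 1`. If
`m > 0` is the least eigenvalue of `S(1)`, then `tr (P S(1)) ≥ m tr P`, and `tr P` is the sum of all
`|R i j|²`. -/
theorem exists_bound_of_energy_le_one (hk : 0 < k) {S : BipartiteMatrix k} (hS : S.PosSemidef)
    (hM : (act S 1).PosDef) :
    ∃ C : ℝ, ∀ R, energy S R ≤ 1 → ∀ i j, ‖R i j‖ ≤ C := by
  obtain ⟨m, v, hv, hmv, hm⟩ := hM.isHermitian.exists_posSemidef_sub_smul hk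
  have hm0 : 0 < m := by
    have h := hM.dotProduct_mulVec_pos hv
    rw [hmv, dotProduct_smul, smul_eq_mul] at h
    have h2 : 0 < star v ⬝ᵥ v := dotProduct_star_self_pos_iff.2 hv
    have h3 := (Complex.lt_def.1 h).1
    rw [Complex.re_ofReal_mul, Complex.zero_re] at h3
    exact pos_of_mul_pos_left h3 (Complex.lt_def.1 h2).1.le
  refine ⟨√(((act S 1).trace.re + 1) / (2 * m)), fun R hR i j => ?_⟩
  have h1 := (Complex.le_def.1 (trace_mul_act_nonneg hS (1 - R * Rᴴ))).1
  have h2 := (Complex.le_def.1 (hm.conjTranspose_mul_mul_same R).trace_nonneg).1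
  have h3 := trace_mul_act_comm hS.isHermitian 1 (R * Rᴴ)
  have h4 : (Rᴴ * act S 1 * R).trace = (R * Rᴴ * act S 1).trace := by
    rw [Matrix.trace_mul_comm, Matrix.mul_assoc]
  have h5 : (Rᴴ * R).trace.re = ∑ j, ∑ i, ‖R i j‖ ^ 2 := by
    simp [Matrix.trace, Matrix.mul_apply, ← Complex.normSq_eq_norm_sq, Complex.normSq_apply]
  have h6 : ‖R i j‖ ^ 2 ≤ ∑ j, ∑ i, ‖R i j‖ ^ 2 :=
    (Finset.single_le_sum (f := fun i => ‖R i j‖ ^ 2) (fun _ _ => by positivity)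
      (Finset.mem_univ i)).trans
    (Finset.single_le_sum (f := fun j => ∑ i, ‖R i j‖ ^ 2) (fun _ _ => by positivity)
      (Finset.mem_univ j))
  unfold energy at hR
  simp only [Matrix.conjTranspose_mul, Matrix.conjTranspose_conjTranspose,
    Matrix.conjTranspose_one, Matrix.one_mul, Matrix.conjTranspose_sub] at h3 h1
  simp only [map_sub, Matrix.sub_mul, Matrix.mul_sub, Matrix.one_mul, Matrix.trace_sub,
    Complex.sub_re, Complex.zero_re, h3, Matrix.mul_smul, Matrix.smul_mul, Matrix.mul_one,
    Matrix.trace_smul, h4, smul_eq_mul, Complex.re_ofReal_mul, h5] at h1 h2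
  simp only [RCLike.star_def, Complex.conj_re] at h1
  apply Real.le_sqrt_of_sq_le
  rw [le_div_iff₀ (by positivity)]
  nlinarith

/-- The energy has degree 4 and the determinant degree `k` in `R`, so maximality on the compact set
of energy at most 1 rescales to an inequality free of constraints. -/
theorem exists_maximizer (hk : 0 < k) {S : BipartiteMatrix k} (hS : S.PosSemidef)
    (hM : (act S 1).PosDef) :
    ∃ R, IsUnit R ∧ energy S R ≤ 1 ∧ ∀ R', ‖R'.det‖ ^ 4 ≤ ‖R.det‖ ^ 4 * energy S R' ^ k := by
  obtain ⟨C, hC⟩ := exists_bound_of_energy_le_one hk hS hM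
  have hcomp : IsCompact {R | energy S R ≤ 1} := by
    refine IsCompact.of_isClosed_subset (s := Set.pi Set.univ fun _ : Fin k =>
      Set.pi Set.univ fun _ : Fin k => Metric.closedBall (0 : ℂ) C) ?_
      (isClosed_le (continuous_energy S) continuous_const) ?_
    · exact isCompact_univ_pi fun _ => isCompact_univ_pi fun _ => isCompact_closedBall _ _
    · intro R hR i _ j _
      simpa using hC R hR i j
  obtain ⟨R, hR, hmax⟩ := hcomp.exists_isMaxOn ⟨0, by simp [energy]⟩
    (f := fun R => ‖R.det‖) (by fun_prop)
  have hmax' : ∀ R', energy S R' ≤ 1 → ‖R'.det‖ ≤ ‖R.det‖ := fun R' h => hmax h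
  have hdet : ∀ (c : ℝ) (R' : Matrix (Fin k) (Fin k) ℂ), 0 ≤ c →
      ‖((c : ℂ) • R').det‖ = c ^ k * ‖R'.det‖ := fun c R' hc => by
    rw [Matrix.det_smul]
    simp [abs_of_nonneg hc]
  have key : ∀ R', ‖R'.det‖ ^ 4 ≤ ‖R.det‖ ^ 4 * energy S R' ^ k := by
    intro R'
    rcases (energy_nonneg hS R').eq_or_lt with h0 | h0
    -- With zero energy every multiple of `R'` is admissible, so a nonzero determinant could be
    -- scaled beyond the maximum.
    · by_contra hne
      rw [← h0, zero_pow hk.ne', mul_zero, not_le] at hne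
      have hd : 0 < ‖R'.det‖ := by
        rcases (norm_nonneg R'.det).eq_or_lt with h | h
        · rw [← h] at hne; norm_num at hne
        · exact h
      set c := ‖R.det‖ / ‖R'.det‖ + 1
      have hc : 1 ≤ c := le_add_of_nonneg_left (by positivity)
      have h1 := hmax' ((c : ℂ) • R') (by rw [energy_smul, ← h0]; norm_num)
      rw [hdet c R' (by linarith)] at h1
      have h2 : c ≤ c ^ k := le_self_pow₀ hc hk.ne'
      have h3 : c * ‖R'.det‖ = ‖R.det‖ + ‖R'.det‖ := by
        simp only [c]; field_simp
      nlinarith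
    · set e := energy S R'
      -- The fourth root of `1/e` normalizes the energy to 1.
      set c := √(√e⁻¹)
      have hc4 : c ^ 4 * e = 1 := by
        have : c ^ 4 = (c ^ 2) ^ 2 := by ring
        rw [this, Real.sq_sqrt (by positivity), Real.sq_sqrt (by positivity),
          inv_mul_cancel₀ h0.ne']
      have h1 := hmax' ((c : ℂ) • R') (by rw [energy_smul, hc4])
      rw [hdet c R' (by positivity)] at h1
      have h2 := pow_le_pow_left₀ (by positivity) h1 4
      calc ‖R'.det‖ ^ 4 = (c ^ 4 * e) ^ k * ‖R'.det‖ ^ 4 := by rw [hc4]; simp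
        _ = (c ^ k * ‖R'.det‖) ^ 4 * e ^ k := by ring
        _ ≤ _ := by gcongr
  refine ⟨R, ?_, hR, key⟩
  rw [Matrix.isUnit_iff_isUnit_det, isUnit_iff_ne_zero]
  intro h
  have := key 1
  rw [h] at this
  norm_num at this

theorem exists_congr_act_one (hk : 0 < k) {S : BipartiteMatrix k} (hS : S.PosSemidef)
    (hpos : ∀ X : Matrix (Fin k) (Fin k) ℂ, X.PosSemidef → (act S X).PosSemidef)
    (hM : (act S 1).PosDef) :
    ∃ R : Matrix (Fin k) (Fin k) ℂ, IsUnit R ∧ act (congr R S) 1 = (1 / k : ℂ) • 1 := by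
  obtain ⟨R, hR, hle, hmax⟩ := exists_maximizer hk hS hM
  refine ⟨R, hR, ?_⟩
  set Q := act (congr R S) 1 with hQdef
  have hQ : Q.PosSemidef := by
    rw [hQdef, act_congr]
    exact (hpos _ (by simpa using posSemidef_self_mul_conjTranspose R)).conjTranspose_mul_mul_same R
  have hS' : (congr R S).PosSemidef := posSemidef_congr hS R
  have htr : Q.trace.re ≤ 1 := by
    rw [hQdef, trace_act_congr_one]; exact hle
  have hd : 0 < ‖R.det‖ := by
    rw [Matrix.isUnit_iff_isUnit_det, isUnit_iff_ne_zero] at hR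
    exact norm_pos_iff.2 hR
  have hW : ∀ W : Matrix (Fin k) (Fin k) ℂ, ‖W.det‖ ^ 4 ≤ energy (congr R S) W ^ k := by
    intro W
    have h := hmax (R * W)
    rw [Matrix.det_mul, norm_mul, mul_pow, ← energy_congr] at h
    exact le_of_mul_le_mul_left h (by positivity)
  -- Perturb the maximizer by `W` with `W Wᴴ = 1 + t v vᴴ`: the determinant is exactly affine in
  -- `t`, the energy quadratic, and comparing at first order gives `Q ≥ 1/k`.
  have hquad : ∀ v : Fin k → ℂ, (star v ⬝ᵥ v).re ≤ k * (star v ⬝ᵥ Q *ᵥ v).re := by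
    intro v
    set V := vecMulVec v (star v) with hV
    have hVps : V.PosSemidef := posSemidef_vecMulVec_self_star v
    apply le_mul_of_forall_sq_le_pow (r := (V * act (congr R S) V).trace.re)
    intro t ht
    have hps : (1 + (t : ℂ) • V).PosSemidef :=
      PosSemidef.one.add (hVps.smul (by simpa using ht.le))
    obtain ⟨W, hWeq⟩ : ∃ W : Matrix (Fin k) (Fin k) ℂ, 1 + (t : ℂ) • V = W * Wᴴ := by
      obtain ⟨B, hB⟩ := hps.exists_eq_conjTranspose_mul_self
      exact ⟨Bᴴ, by rw [hB, conjTranspose_conjTranspose]⟩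
    have h1 := hW W
    have h2 : ‖W.det‖ ^ 2 = 1 + t * (star v ⬝ᵥ v).re := by
      have h3 : (W * Wᴴ).det = 1 + (t : ℂ) * (star v ⬝ᵥ v) := by
        rw [← hWeq, hV, ← smul_vecMulVec, vecMulVec_eq Unit,
          det_one_add_replicateCol_mul_replicateRow, dotProduct_smul, smul_eq_mul]
      rw [Matrix.det_mul, Matrix.det_conjTranspose, RCLike.star_def, Complex.mul_conj] at h3
      rw [← Complex.normSq_eq_norm_sq]
      simpa using congrArg Complex.re h3
    have h3 : energy (congr R S) W = Q.trace.re + 2 * t * (star v ⬝ᵥ Q *ᵥ v).re +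
        t ^ 2 * (V * act (congr R S) V).trace.re := by
      have h4 : (V * Q).trace = star v ⬝ᵥ Q *ᵥ v := by
        rw [hV, vecMulVec_mul, trace_vecMulVec, dotProduct_comm, ← dotProduct_mulVec]
      have h5 := trace_mul_act_comm hS'.isHermitian 1 V
      rw [hVps.isHermitian.eq, ← hQdef, h4, conjTranspose_one, Matrix.one_mul] at h5
      rw [energy, ← hWeq]
      simp only [map_add, map_smul, Matrix.add_mul, Matrix.mul_add, Matrix.one_mul,
        Matrix.smul_mul, Matrix.mul_smul, trace_add, trace_smul, ← hQdef, h4, h5, Complex.add_re,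
        smul_eq_mul, Complex.re_ofReal_mul, RCLike.star_def, Complex.conj_re]
      ring
    calc _ = ‖W.det‖ ^ 4 := by rw [← h2]; ring
      _ ≤ _ := h1
      _ ≤ _ := by
        gcongr
        · exact energy_nonneg hS' W
        · rw [h3]; linarith
  have hk' : (0 : ℝ) < k := by exact_mod_cast hk
  have hdiff : (Q - (1 / k : ℂ) • (1 : Matrix (Fin k) (Fin k) ℂ)).PosSemidef := by
    have hone : (((1 / k : ℂ)) • (1 : Matrix (Fin k) (Fin k) ℂ)).IsHermitian := by
      rw [IsHermitian, conjTranspose_smul, conjTranspose_one]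
      simp
    refine PosSemidef.of_dotProduct_mulVec_nonneg (hQ.isHermitian.sub hone) fun v => ?_
    have h1 := hQ.dotProduct_mulVec_nonneg v
    have h2 : 0 ≤ star v ⬝ᵥ v := dotProduct_star_self_nonneg v
    rw [Complex.le_def] at h1 h2
    rw [sub_mulVec, smul_mulVec, one_mulVec, dotProduct_sub, dotProduct_smul, Complex.le_def]
    have h3 : (1 / k : ℂ) = ((1 / k : ℝ) : ℂ) := by push_cast; rfl
    rw [h3, smul_eq_mul]
    refine ⟨?_, ?_⟩
    · rw [Complex.sub_re, Complex.re_ofReal_mul, Complex.zero_re, sub_nonneg, one_div,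
        inv_mul_le_iff₀ hk']
      exact hquad v
    · rw [Complex.sub_im, Complex.im_ofReal_mul, ← h1.2, ← h2.2]
      simp
  -- A positive matrix whose trace is at most `1 - 1 = 0` vanishes.
  have h0 : (Q - (1 / k : ℂ) • (1 : Matrix (Fin k) (Fin k) ℂ)).trace = 0 := by
    refine le_antisymm ?_ hdiff.trace_nonneg
    have h1 := Complex.le_def.1 hdiff.trace_nonneg
    rw [Complex.le_def]
    refine ⟨?_, h1.2.symm⟩
    simp [hk.ne']
    linarith
  exact sub_eq_zero.1 (hdiff.trace_eq_zero_iff.1 h0)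


/-! ### Eigenbases of Hermitian matrices -/

/-- The matrix of the flip `a ⊗ b ↦ b ⊗ a`. -/
def flip (k : ℕ) : BipartiteMatrix k := (1 : BipartiteMatrix k).submatrix id Prod.swap

theorem mul_flip (S : BipartiteMatrix k) : S * flip k = S.submatrix id Prod.swap := by
  ext p q
  simp [flip, Matrix.mul_apply, Matrix.one_apply]

theorem flip_mul (S : BipartiteMatrix k) : flip k * S = S.submatrix Prod.swap id := by
  ext p q
  have h : ∀ x : Fin k × Fin k, p = x.swap ↔ p.swap = x := fun x => by
    rw [← Prod.swap_inj, Prod.swap_swap]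
  simp [flip, Matrix.mul_apply, Matrix.one_apply, h]

theorem flip_mul_flip : flip k * flip k = 1 := by
  rw [mul_flip]
  ext p q
  rw [flip, submatrix_submatrix]
  simp [Matrix.one_apply]

theorem conjTranspose_flip : (flip k)ᴴ = flip k := by
  ext p q
  have h : q = p.swap ↔ p = q.swap := by rw [← Prod.swap_inj, Prod.swap_swap, eq_comm]
  simp [flip, Matrix.one_apply, h]

/-- A unitary matrix that maps real vectors to vectorizations of Hermitian matrices. -/
noncomputable def hermitianUnitary (k : ℕ) : BipartiteMatrix k :=
  ((1 + Complex.I) / 2) • 1 + ((1 - Complex.I) / 2) • flip k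

theorem conjTranspose_hermitianUnitary :
    (hermitianUnitary k)ᴴ =
      ((1 - Complex.I) / 2) • 1 + ((1 + Complex.I) / 2) • flip k := by
  rw [hermitianUnitary, conjTranspose_add, conjTranspose_smul, conjTranspose_smul,
    conjTranspose_flip, conjTranspose_one]
  simp [sub_eq_add_neg]

theorem transpose_flip : (flip k)ᵀ = flip k := by
  ext p q
  have h : q = p.swap ↔ p = q.swap := by rw [← Prod.swap_inj, Prod.swap_swap, eq_comm]
  simp [flip, Matrix.one_apply, h]

theorem map_star_hermitianUnitary :
    (hermitianUnitary k).map star = (hermitianUnitary k)ᴴ := by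
  have h : (hermitianUnitary k)ᵀ = hermitianUnitary k := by
    simp [hermitianUnitary, transpose_flip]
  conv_lhs => rw [← h]
  rfl

/-- The adjoint here is also the entrywise conjugate, so this says that each column is fixed by `v ↦
flip v̄`, which is conjugate transposition on vectorized matrices. -/
theorem flip_mul_conjTranspose_hermitianUnitary :
    flip k * (hermitianUnitary k)ᴴ = hermitianUnitary k := by
  rw [conjTranspose_hermitianUnitary, hermitianUnitary, Matrix.mul_add, Matrix.mul_smul,
    Matrix.mul_smul, flip_mul_flip, Matrix.mul_one, add_comm]

theorem hermitianUnitary_mul_flip :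
    hermitianUnitary k * flip k = (hermitianUnitary k)ᴴ := by
  rw [conjTranspose_hermitianUnitary, hermitianUnitary, Matrix.add_mul, Matrix.smul_mul,
    Matrix.smul_mul, flip_mul_flip, Matrix.one_mul, add_comm]

theorem hermitianUnitary_mul_conjTranspose :
    hermitianUnitary k * (hermitianUnitary k)ᴴ = 1 := by
  rw [conjTranspose_hermitianUnitary, hermitianUnitary]
  simp only [Matrix.mul_add, Matrix.mul_smul, Matrix.add_mul, Matrix.smul_mul, flip_mul_flip,
    Matrix.mul_one, Matrix.one_mul, smul_add, smul_smul]
  have h1 : (1 + Complex.I) / 2 * ((1 - Complex.I) / 2) = 1 / 2 := by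
    linear_combination (-1 / 4 : ℂ) * Complex.I_mul_I
  have h2 : (1 - Complex.I) / 2 * ((1 + Complex.I) / 2) = 1 / 2 := by rw [mul_comm, h1]
  have h3 : (1 + Complex.I) / 2 * ((1 + Complex.I) / 2) =
      -((1 - Complex.I) / 2 * ((1 - Complex.I) / 2)) := by
    linear_combination (1 / 2 : ℂ) * Complex.I_mul_I
  simp only [h1, h2, h3]
  module

/-- Hermiticity of the realignment means that `S` commutes with `v ↦ flip v̄`. Conjugating by
`hermitianUnitary` turns this symmetry into plain complex conjugation, so the real spectral theorem
applies, and its real eigenvectors return as Hermitian matrices. -/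
theorem exists_hermitian_spectral_decomposition {S : BipartiteMatrix k} (hS : S.IsHermitian)
    (hR : (realignment S).IsHermitian) :
    ∃ (V : BipartiteMatrix k) (μ : Fin k × Fin k → ℝ), Vᴴ * V = 1 ∧
      S = V * diagonal (fun m => (μ m : ℂ)) * Vᴴ ∧
      ∀ m, (Matrix.of fun i j => V (i, j) m).IsHermitian := by
  set U := hermitianUnitary k with hU
  have hUU : U * Uᴴ = 1 := hermitianUnitary_mul_conjTranspose
  have hUU' : Uᴴ * U = 1 := mul_eq_one_comm.1 hUU
  have hstar : S.map star = flip k * S * flip k := by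
    rw [flip_mul, mul_flip]
    ext p q
    have := hR.apply (p.2, q.2) (p.1, q.1)
    exact this
  have mulstar : ∀ A B : BipartiteMatrix k, (A * B).map star = A.map star * B.map star :=
    fun A B => Matrix.map_mul (f := starRingEnd ℂ)
  have hreal : (Uᴴ * S * U).map star = Uᴴ * S * U := by
    have h1 : Uᴴ.map star = U := by
      rw [hU, ← map_star_hermitianUnitary]
      ext p q
      simp
    rw [mulstar, mulstar, hstar, h1, map_star_hermitianUnitary, ← hU]
    calc U * (flip k * S * flip k) * Uᴴ = (U * flip k) * S * (flip k * Uᴴ) := by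
          simp only [Matrix.mul_assoc]
      _ = _ := by rw [hU, flip_mul_conjTranspose_hermitianUnitary, hermitianUnitary_mul_flip]
  set T : Matrix (Fin k × Fin k) (Fin k × Fin k) ℝ := (Uᴴ * S * U).map Complex.re with hT
  have hTmap : T.map (Complex.ofRealHom) = Uᴴ * S * U := by
    ext p q
    have h := congrFun (congrFun hreal p) q
    rw [Matrix.map_apply] at h
    exact Complex.conj_eq_iff_re.1 h
  have hTh : T.IsHermitian := by
    have h := (isHermitian_conjTranspose_mul_mul U hS)
    ext p q
    have := congrArg Complex.re (h.apply p q)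
    simpa [hT] using this
  set W : BipartiteMatrix k :=
    (hTh.eigenvectorUnitary : Matrix (Fin k × Fin k) (Fin k × Fin k) ℝ).map Complex.ofRealHom with hW
  have hWstar : (star (hTh.eigenvectorUnitary :
      Matrix (Fin k × Fin k) (Fin k × Fin k) ℝ)).map Complex.ofRealHom = Wᴴ := by
    ext p q
    simp [hW, Matrix.star_eq_conjTranspose]
  have hWW : Wᴴ * W = 1 := by
    rw [← hWstar, hW, ← Matrix.map_mul]
    simp
  have hTspec : Uᴴ * S * U = W * diagonal (fun m => (hTh.eigenvalues m : ℂ)) * Wᴴ := by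
    rw [← hTmap]
    conv_lhs => rw [hTh.spectral_theorem, Unitary.conjStarAlgAut_apply]
    rw [Matrix.map_mul, Matrix.map_mul, hWstar, Matrix.diagonal_map (by simp)]
    rfl
  refine ⟨U * W, hTh.eigenvalues, ?_, ?_, ?_⟩
  · rw [conjTranspose_mul, Matrix.mul_assoc, ← Matrix.mul_assoc Uᴴ, hUU', Matrix.one_mul, hWW]
  · calc S = (U * Uᴴ) * S * (U * Uᴴ) := by rw [hUU, Matrix.one_mul, Matrix.mul_one]
      _ = U * (Uᴴ * S * U) * Uᴴ := by simp only [Matrix.mul_assoc]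
      _ = _ := by rw [hTspec, conjTranspose_mul]; simp only [Matrix.mul_assoc]
  · intro m
    have h1 : flip k * (U * W).map star = U * W := by
      have h2 : W.map star = W := by
        ext p q
        simp [hW]
      rw [mulstar, h2, map_star_hermitianUnitary, ← Matrix.mul_assoc,
        flip_mul_conjTranspose_hermitianUnitary]
    ext i j
    have h := congrFun (congrFun h1 (i, j)) m
    rw [flip_mul] at h
    exact h

/-- Suppose `lam > 1/k`, and let `c` be the least eigenvalue of a Hermitian eigenvector `Y`,
attained at `v`. Applying the positive map to `Y - c ≥ 0` and testing at `v` gives `(lam - 1/k) c ≥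
0`, hence `Y ≥ 0`. With both `X` and `-X` in place of `Y`, this forces `X = 0`. -/
theorem le_one_div_of_act_eq_smul (hk : 0 < k) {S : BipartiteMatrix k}
    (hpos : ∀ X : Matrix (Fin k) (Fin k) ℂ, X.PosSemidef → (act S X).PosSemidef)
    (h1 : act S 1 = (1 / k : ℂ) • 1) {X : Matrix (Fin k) (Fin k) ℂ} (hX : X.IsHermitian)
    (hX0 : X ≠ 0) {lam : ℝ} (h : act S X = (lam : ℂ) • X) : lam ≤ 1 / k := by
  by_contra! hlt
  have key : ∀ Y : Matrix (Fin k) (Fin k) ℂ, Y.IsHermitian → act S Y = (lam : ℂ) • Y →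
      Y.PosSemidef := by
    intro Y hY hYl
    obtain ⟨c, v, hv, hcv, hps⟩ := hY.exists_posSemidef_sub_smul hk
    have h2 := (hpos _ hps).dotProduct_mulVec_nonneg v
    rw [map_sub, map_smul, h1, hYl, sub_mulVec, smul_mulVec, hcv, smul_mulVec, smul_mulVec,
      one_mulVec, smul_smul, smul_smul, ← sub_smul, dotProduct_smul, smul_eq_mul] at h2
    have h3 : (lam * c - c * (1 / k) : ℂ) = ((lam - 1 / k) * c : ℝ) := by push_cast; ring
    rw [h3] at h2
    have h4 := (Complex.le_def.1 h2).1
    rw [Complex.re_ofReal_mul, Complex.zero_re] at h4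
    have h5 : 0 < (star v ⬝ᵥ v).re :=
      (Complex.lt_def.1 (dotProduct_star_self_pos_iff.2 hv)).1
    have h6 : 0 ≤ c := by
      by_contra! hc
      have : (lam - 1 / k) * c < 0 := mul_neg_of_pos_of_neg (by linarith) hc
      nlinarith
    have h7 := hps.add (PosSemidef.one.smul (a := (c : ℂ)) (by simpa using h6))
    rwa [sub_add_cancel] at h7
  have h2 := key X hX h
  have h3 := key (-X) hX.neg (by rw [map_neg, h, smul_neg])
  refine hX0 (h2.trace_eq_zero_iff.1 (le_antisymm ?_ h2.trace_nonneg))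
  simpa using h3.trace_nonneg

end BipartiteMatrix

theorem Matrix.isUnit_of_rank_eq {k : ℕ} {A : Matrix (Fin k) (Fin k) ℂ} (h : A.rank = k) :
    IsUnit A := by
  rw [← mulVec_surjective_iff_isUnit]
  have h1 : LinearMap.range A.mulVecLin = ⊤ := by
    apply Submodule.eq_top_of_finrank_eq
    rw [Module.finrank_fin_fun]
    exact h
  exact LinearMap.range_eq_top.1 h1

/-! ### Positivity of the realigned map and the filter family -/

namespace BipartiteMatrix
variable {k : ℕ}

theorem act_realignment_apply (γ : BipartiteMatrix k) (X : Matrix (Fin k) (Fin k) ℂ)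
    (i a : Fin k) : act (realignment γ) X i a = ∑ j, ∑ b, γ (i, j) (a, b) * X j b :=
  act_apply _ _ _ _

theorem act_realignment_one (γ : BipartiteMatrix k) :
    act (realignment γ) 1 = reducedA γ := by
  ext i a
  simp [act_realignment_apply, reducedA, Matrix.one_apply]

theorem act_realignment_partialTranspose (γ : BipartiteMatrix k)
    (X : Matrix (Fin k) (Fin k) ℂ) :
    act (realignment (partialTranspose γ)) X = act (realignment γ) Xᵀ := by
  ext i a
  rw [act_realignment_apply, act_realignment_apply, Finset.sum_comm]
  rfl

theorem posSemidef_act_realignment {γ : BipartiteMatrix k} (hγ : γ.PosSemidef)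
    {X : Matrix (Fin k) (Fin k) ℂ} (hX : X.PosSemidef) :
    (act (realignment γ) X).PosSemidef := by
  obtain ⟨B, rfl⟩ := hX.exists_eq_conjTranspose_mul_self
  -- `K m` is the identity tensored with row `m` of `B`, so the image is a sum of compressions of
  -- `γ`.
  let K : Fin k → Matrix (Fin k × Fin k) (Fin k) ℂ :=
    fun m => Matrix.of fun p a => if p.1 = a then B m p.2 else 0
  have h : act (realignment γ) (Bᴴ * B) = ∑ m, (K m)ᴴ * γ * K m := by
    ext i a
    have h1 : ∀ m, ((K m)ᴴ * γ * K m) i a =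
        ∑ j, ∑ b, star (B m j) * γ (i, j) (a, b) * B m b := by
      intro m
      simp only [K, Matrix.mul_apply, Fintype.sum_prod_type, conjTranspose_apply, of_apply,
        apply_ite star, star_zero, ite_mul, zero_mul, mul_ite, mul_zero,
        Finset.sum_ite_irrel, Finset.sum_const_zero, Finset.sum_ite_eq', Finset.mem_univ, if_true,
        Finset.sum_mul]
      exact Finset.sum_comm
    rw [act_realignment_apply, Matrix.sum_apply]
    simp only [h1, Matrix.mul_apply, Finset.mul_sum, conjTranspose_apply]
    rw [Finset.sum_comm_cycle]
    refine Finset.sum_congr rfl fun m _ => ?_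
    refine Finset.sum_congr rfl fun j _ => Finset.sum_congr rfl fun b _ => ?_
    ring
  rw [h]
  exact posSemidef_sum _ fun m _ => hγ.conjTranspose_mul_mul_same (K m)

theorem isHermitian_partialTranspose {γ : BipartiteMatrix k} (hγ : γ.IsHermitian) :
    (partialTranspose γ).IsHermitian :=
  Matrix.IsHermitian.ext fun p q => hγ.apply (p.1, q.2) (q.1, p.2)

theorem isHermitian_congr {S : BipartiteMatrix k} (hS : S.IsHermitian)
    (R : Matrix (Fin k) (Fin k) ℂ) : (congr R S).IsHermitian := by
  have h := isHermitian_conjTranspose_mul_mul (R ⊗ₖ R.entrywiseConj) hS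
  rwa [Matrix.conjTranspose_kronecker, conjTranspose_entrywiseConj] at h

/-- Partial transposition turns `S` into `S F`, with `F` the flip. Since `S` and `S F` are
Hermitian, `F` commutes with `S`, and compressing both by `1 - F` gives opposite matrices `±2(S - S
F)`. Both are positive, so `S = S F`. -/
theorem partialTranspose_eq_self {γ : BipartiteMatrix k} (h1 : (realignment γ).PosSemidef)
    (h2 : (realignment (partialTranspose γ)).PosSemidef) : partialTranspose γ = γ := by
  set S := realignment γ with hS
  have hS' : realignment (partialTranspose γ) = S * flip k := by rw [mul_flip]; rfl
  rw [hS'] at h2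
  have hcomm : flip k * S = S * flip k := by
    have := h2.isHermitian.eq
    rwa [conjTranspose_mul, conjTranspose_flip, h1.isHermitian.eq] at this
  have hF : (1 - flip k)ᴴ = 1 - flip k := by
    rw [conjTranspose_sub, conjTranspose_one, conjTranspose_flip]
  have h3 := h1.conjTranspose_mul_mul_same (1 - flip k)
  have h4 := h2.conjTranspose_mul_mul_same (1 - flip k)
  have h5 : (1 - flip k) * S * (1 - flip k) = (2 : ℂ) • (S - S * flip k) := by
    simp only [Matrix.sub_mul, Matrix.mul_sub, Matrix.one_mul, Matrix.mul_one, hcomm,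
      Matrix.mul_assoc, flip_mul_flip]
    module
  have h6 : (1 - flip k) * (S * flip k) * (1 - flip k) = -((2 : ℂ) • (S - S * flip k)) := by
    rw [← h5, Matrix.mul_assoc, Matrix.mul_assoc S, Matrix.mul_sub (flip k), flip_mul_flip,
      Matrix.mul_one, ← neg_sub (1 : BipartiteMatrix k), Matrix.mul_neg, Matrix.mul_neg,
      Matrix.mul_assoc]
  rw [hF, h5] at h3
  rw [hF, h6] at h4
  have h7 := h3.trace_eq_zero_iff.1
    (le_antisymm (by simpa using h4.trace_nonneg) h3.trace_nonneg)
  have h8 : realignment (partialTranspose γ) = realignment γ := by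
    rw [hS', ← hS]
    exact (sub_eq_zero.1 ((smul_eq_zero.1 h7).resolve_left two_ne_zero)).symm
  exact congrArg realignment h8

theorem act_mul_diagonal_mul_conjTranspose (V : BipartiteMatrix k) (μ : Fin k × Fin k → ℝ)
    (hV : Vᴴ * V = 1) (m : Fin k × Fin k) :
    act (V * diagonal (fun m => (μ m : ℂ)) * Vᴴ) (Matrix.of fun i j => V (i, j) m) =
      (μ m : ℂ) • Matrix.of fun i j => V (i, j) m := by
  have h1 : V * diagonal (fun m => (μ m : ℂ)) * Vᴴ * V = V * diagonal (fun m => (μ m : ℂ)) := by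
    rw [Matrix.mul_assoc, hV, Matrix.mul_one]
  ext i j
  have h2 := congrFun (congrFun h1 (i, j)) m
  rw [mul_diagonal, Matrix.mul_apply, Fintype.sum_prod_type] at h2
  rw [act_apply, Matrix.smul_apply, Matrix.of_apply, smul_eq_mul, mul_comm]
  exact h2

theorem trace_mul_column {V : BipartiteMatrix k} (hV : Vᴴ * V = 1)
    (hh : ∀ m, (Matrix.of fun i j => V (i, j) m).IsHermitian) (m n : Fin k × Fin k) :
    ((Matrix.of fun i j => V (i, j) m) * (Matrix.of fun i j => V (i, j) n)).trace =
      if m = n then 1 else 0 := by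
  rw [← (hh m).eq, ← Matrix.one_apply, ← hV, trace_conjTranspose_mul]
  rfl

/-- Removing the component along the identity matrix keeps `S` positive semidefinite. -/
theorem posSemidef_sub_vecMulVec (hk : 0 < k) {S : BipartiteMatrix k} (hS : S.PosSemidef)
    (h1 : act S 1 = (1 / k : ℂ) • 1) :
    (S - (1 / k ^ 2 : ℂ) • vecMulVec (vec 1) (star (vec 1))).PosSemidef := by
  have hk' : (k : ℂ) ≠ 0 := by exact_mod_cast hk.ne'
  set w : Fin k × Fin k → ℂ := vec 1 with hw
  have hSw : S *ᵥ w = (1 / k : ℂ) • w := by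
    have := vec_transpose_act S 1
    rw [h1, transpose_smul, transpose_one, vec_smul] at this
    exact this.symm
  have hwS : star w ᵥ* S = (1 / k : ℂ) • star w := by
    have := congrArg star hSw
    rw [star_mulVec, hS.isHermitian.eq, star_smul] at this
    simpa using this
  have hww : star w ⬝ᵥ w = k := by
    rw [hw, star_vec_dotProduct_vec]
    simp
  set P := vecMulVec w (star w) with hPdef
  have hSP : S * P = (1 / k : ℂ) • P := by rw [hPdef, mul_vecMulVec, hSw, smul_vecMulVec]
  have hPS : P * S = (1 / k : ℂ) • P := by rw [hPdef, vecMulVec_mul, hwS, vecMulVec_smul]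
  have hPP : P * P = (k : ℂ) • P := by
    rw [hPdef, vecMulVec_mul_vecMulVec, hww, vecMulVec_smul]
  have hPh : (1 - (1 / k : ℂ) • P)ᴴ = 1 - (1 / k : ℂ) • P := by
    rw [hPdef, conjTranspose_sub, conjTranspose_smul, conjTranspose_vecMulVec, conjTranspose_one]
    simp
  -- `P / k` is the orthogonal projection onto the eigenvector `w`, so compressing `S` to the
  -- complement removes exactly `P / k²`.
  have h := hS.conjTranspose_mul_mul_same (1 - (1 / k : ℂ) • P)
  convert! h using 1
  rw [hPh]
  simp only [Matrix.sub_mul, Matrix.mul_sub, Matrix.one_mul, Matrix.mul_one, Matrix.smul_mul,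
    Matrix.mul_smul, hSP, hPS, hPP, smul_smul]
  match_scalars <;> field_simp
  ring

theorem realignment_vecMulVec_vec_one :
    realignment (vecMulVec (vec (1 : Matrix (Fin k) (Fin k) ℂ)) (star (vec 1))) = 1 := by
  rw [← one_kronecker_one]
  ext p q
  simp [realignment, vecMulVec_apply, vec, Matrix.one_apply, eq_comm]

/-- The eigenvalue `1/k` may be degenerate, so an arbitrary eigenbasis need not contain the
identity. Its component is removed first, the remainder `S₁` is diagonalized, and the identity is
put back as index `0`. -/
theorem exists_filterFamily (hk : 0 < k) {S : BipartiteMatrix k} (hS : S.PosSemidef)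
    (hR : (realignment S).IsHermitian)
    (hpos : ∀ X : Matrix (Fin k) (Fin k) ℂ, X.PosSemidef → (act S X).PosSemidef)
    (h1 : act S 1 = (1 / k : ℂ) • 1) :
    ∃ (n : ℕ) (lam : Fin (n + 1) → ℝ) (g : Fin (n + 1) → Matrix (Fin k) (Fin k) ℂ),
      IsFilterFamily lam g ∧
        realignment S = ∑ i, (lam i : ℂ) • (g i ⊗ₖ (g i).entrywiseConj) := by
  have hkr : (0 : ℝ) < k := by exact_mod_cast hk
  have hkc : (k : ℂ) ≠ 0 := by exact_mod_cast hk.ne'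
  set S₁ := S - (1 / k ^ 2 : ℂ) • vecMulVec (vec 1) (star (vec 1)) with hS₁
  have hps : S₁.PosSemidef := posSemidef_sub_vecMulVec hk hS h1
  have hactS₁ : ∀ X, act S₁ X = act S X - (1 / k ^ 2 * X.trace : ℂ) • 1 := by
    intro X
    apply transpose_injective
    apply vec_bijective.injective
    rw [vec_transpose_act, hS₁, sub_mulVec, smul_mulVec, vecMulVec_mulVec, ← vec_transpose_act,
      star_vec_dotProduct_vec, conjTranspose_one, Matrix.one_mul, trace_transpose, transpose_sub,
      transpose_smul, transpose_one, vec_sub, vec_smul, op_smul_eq_smul, smul_smul]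
  have hR₁ : (realignment S₁).IsHermitian := by
    have h : realignment S₁ = realignment S - ((1 / k ^ 2 : ℝ) : ℂ) • 1 := by
      rw [← realignment_vecMulVec_vec_one, hS₁]
      push_cast
      rfl
    rw [h]
    refine hR.sub ?_
    rw [IsHermitian, conjTranspose_smul, conjTranspose_one, RCLike.star_def, Complex.conj_ofReal]
  obtain ⟨V, μ, hV, hdec, hherm⟩ := exists_hermitian_spectral_decomposition hps.isHermitian hR₁
  set G : Fin k × Fin k → Matrix (Fin k) (Fin k) ℂ := fun m => Matrix.of fun i j => V (i, j) m
    with hG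
  have horth : ∀ m n, (G m * G n).trace = if m = n then 1 else 0 := trace_mul_column hV hherm
  have hμ : ∀ m, 0 ≤ μ m := by
    have h := hps.conjTranspose_mul_mul_same V
    rw [hdec] at h
    have h2 : Vᴴ * (V * diagonal (fun m => (μ m : ℂ)) * Vᴴ) * V =
        diagonal (fun m => (μ m : ℂ)) := by
      calc _ = (Vᴴ * V) * diagonal (fun m => (μ m : ℂ)) * (Vᴴ * V) := by
            simp only [Matrix.mul_assoc]
        _ = _ := by rw [hV, Matrix.one_mul, Matrix.mul_one]
    rw [h2, posSemidef_diagonal_iff] at h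
    intro m
    simpa using h m
  have hact₁ : ∀ m, act S₁ (G m) = (μ m : ℂ) • G m := fun m => by
    rw [hdec]; exact act_mul_diagonal_mul_conjTranspose V μ hV m
  -- `S₁` is self-adjoint and kills the identity, so eigenvectors with nonzero eigenvalue are
  -- orthogonal to the identity.
  have htr : ∀ m, 0 < μ m → (G m).trace = 0 := by
    intro m hm
    have h2 := trace_mul_act_comm hps.isHermitian 1 (G m)
    have h3 : act S₁ 1 = 0 := by
      rw [hactS₁, h1, trace_one, Fintype.card_fin, ← sub_smul]
      have : (1 / k - 1 / k ^ 2 * k : ℂ) = 0 := by field_simp; ring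
      rw [this, zero_smul]
    rw [h3, hact₁] at h2
    simpa [hm.ne'] using h2
  have hact : ∀ m, 0 < μ m → act S (G m) = (μ m : ℂ) • G m := by
    intro m hm
    have h2 := hactS₁ (G m)
    rw [htr m hm, hact₁] at h2
    simpa using h2.symm
  have hle : ∀ m, 0 < μ m → μ m ≤ 1 / k := by
    intro m hm
    refine le_one_div_of_act_eq_smul hk hpos h1 (hherm m) ?_ (hact m hm)
    intro h0
    have h2 := horth m m
    simp only [hG] at h2
    rw [h0] at h2
    simp at h2
  have hsq : ((1 / √(k : ℝ) : ℝ) : ℂ) * ((1 / √(k : ℝ) : ℝ) : ℂ) = 1 / k := by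
    rw [← Complex.ofReal_mul, div_mul_div_comm, Real.mul_self_sqrt hkr.le]
    simp
  let e := (Fintype.equivFin {m // 0 < μ m}).symm
  set g₀ : Matrix (Fin k) (Fin k) ℂ := ((1 / √(k : ℝ) : ℝ) : ℂ) • 1 with hg₀
  have hg₀tr : ∀ X : Matrix (Fin k) (Fin k) ℂ, X.trace = 0 → (g₀ * X).trace = 0 := by
    intro X hX
    rw [hg₀, Matrix.smul_mul, Matrix.one_mul, trace_smul, hX, smul_zero]
  refine ⟨Fintype.card {m // 0 < μ m}, Fin.cons (1 / k) fun i => μ (e i),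
    Fin.cons g₀ fun i => G (e i), ?_, ?_⟩
  · refine ⟨rfl, rfl, ?_, ?_, ?_, ?_, ?_⟩
    · exact Fin.cases (by simpa using hk) fun i => (e i).2
    · exact Fin.cases le_rfl fun i => hle _ (e i).2
    · refine Fin.cases ?_ fun i => hherm _
      simp only [Fin.cons_zero]
      rw [IsHermitian, hg₀, conjTranspose_smul, conjTranspose_one, RCLike.star_def,
        Complex.conj_ofReal]
    · refine Fin.cases (Fin.cases (by simp) fun j _ => ?_) fun i => Fin.cases (fun _ => ?_) ?_
      · exact hg₀tr _ (htr _ (e j).2)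
      · rw [trace_mul_comm]
        exact hg₀tr _ (htr _ (e i).2)
      · intro j hij
        refine (horth _ _).trans (if_neg fun h => hij ?_)
        exact congrArg Fin.succ (e.injective (Subtype.ext h))
    · refine Fin.cases ?_ fun i => ?_
      · simp only [Fin.cons_zero]
        rw [sq, hg₀, Matrix.smul_mul, Matrix.mul_smul, Matrix.one_mul, smul_smul, hsq, trace_smul,
          trace_one]
        simp [hkc]
      · rw [sq]
        exact (horth _ _).trans (if_pos rfl)
  -- Only positive eigenvalues are indexed; the omitted ones are zero and contribute nothing.
  · have hsum : ∀ f : Fin k × Fin k → ℂ, ∑ i, (μ (e i) : ℂ) * f (e i) = ∑ m, (μ m : ℂ) * f m := by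
      intro f
      rw [Equiv.sum_comp e (fun m : {m // 0 < μ m} => (μ m : ℂ) * f m)]
      rw [← Finset.sum_subtype (Finset.univ.filter fun m => 0 < μ m) (by simp)
        (fun m => (μ m : ℂ) * f m)]
      refine Finset.sum_filter_of_ne fun m _ hm => (hμ m).lt_of_ne fun h => hm ?_
      rw [← h, Complex.ofReal_zero, zero_mul]
    ext ⟨i, j⟩ ⟨a, b⟩
    rw [Fin.sum_univ_succ, Matrix.add_apply, Matrix.sum_apply]
    simp only [Fin.cons_zero, Fin.cons_succ, Matrix.smul_apply, smul_eq_mul, kroneckerMap_apply]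
    rw [hsum fun m => G m i a * (G m).entrywiseConj j b]
    have h2 := congrFun (congrFun hdec (i, a)) (j, b)
    rw [Matrix.mul_apply] at h2
    simp only [mul_diagonal, conjTranspose_apply] at h2
    have h3 : S (i, a) (j, b) = S₁ (i, a) (j, b) + (1 / k ^ 2 : ℂ) *
        ((1 : Matrix (Fin k) (Fin k) ℂ) i a * (1 : Matrix (Fin k) (Fin k) ℂ) j b) := by
      simp [hS₁, vecMulVec_apply, vec, Matrix.one_apply, eq_comm]
    have h4 : g₀ i a * g₀.entrywiseConj j b = (1 / k : ℂ) *
        ((1 : Matrix (Fin k) (Fin k) ℂ) i a * (1 : Matrix (Fin k) (Fin k) ℂ) j b) := by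
      have h5 : g₀.entrywiseConj j b = ((1 / √(k : ℝ) : ℝ) : ℂ) *
          (1 : Matrix (Fin k) (Fin k) ℂ) j b := by
        rw [Matrix.entrywiseConj, Matrix.map_apply, hg₀, Matrix.smul_apply, smul_eq_mul, star_mul',
          RCLike.star_def, Complex.conj_ofReal]
        by_cases h : j = b <;> simp [h, Matrix.one_apply]
      rw [h5, hg₀, Matrix.smul_apply, smul_eq_mul, mul_mul_mul_comm, hsq]
    rw [h4]
    change S (i, a) (j, b) = _
    rw [h3, h2, add_comm]
    congr 1
    · push_cast
      ring
    · refine Finset.sum_congr rfl fun m _ => ?_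
      simp only [hG, Matrix.entrywiseConj, Matrix.map_apply, of_apply]
      ring

end BipartiteMatrix
-- Assembly of the two cases
open BipartiteMatrix

theorem mainTheorem2 (k : ℕ) (hk : 0 < k) (γ : BipartiteMatrix k) (hγ : γ.PosSemidef)
    (hrank : (BipartiteMatrix.reducedA γ).rank = k) :
    ∃ R : Matrix (Fin k) (Fin k) ℂ, IsUnit R ∧
      ((BipartiteMatrix.realignment (BipartiteMatrix.partialTranspose γ)).PosSemidef →
        (∃ (n : ℕ) (lam : Fin (n + 1) → ℝ) (g : Fin (n + 1) → Matrix (Fin k) (Fin k) ℂ),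
          IsFilterFamily lam g ∧
          (Rᴴ ⊗ₖ Rᴴ) * γ * (R ⊗ₖ R) = ∑ i, (lam i : ℂ) • (g i ⊗ₖ g i)) ∧
        BipartiteMatrix.IsSPC ((Rᴴ ⊗ₖ Rᴴ) * γ * (R ⊗ₖ R))) ∧
      ((BipartiteMatrix.realignment γ).PosSemidef →
        (∃ (n : ℕ) (lam : Fin (n + 1) → ℝ) (g : Fin (n + 1) → Matrix (Fin k) (Fin k) ℂ),
          IsFilterFamily lam g ∧
          (Rᴴ ⊗ₖ Rᵀ) * γ * (R ⊗ₖ R.entrywiseConj) =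
            ∑ i, (lam i : ℂ) • (g i ⊗ₖ (g i).entrywiseConj)) ∧
        ((Rᴴ ⊗ₖ Rᵀ) * γ * (R ⊗ₖ R.entrywiseConj)).PosSemidef ∧
        (BipartiteMatrix.realignment
          ((Rᴴ ⊗ₖ Rᵀ) * γ * (R ⊗ₖ R.entrywiseConj))).PosSemidef ∧
        (BipartiteMatrix.IsRealignmentInvariant γ →
          BipartiteMatrix.IsRealignmentInvariant
            ((Rᴴ ⊗ₖ Rᵀ) * γ * (R ⊗ₖ R.entrywiseConj)))) := by
  have hM : (act (realignment γ) 1).PosDef :=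
    (posSemidef_act_realignment hγ PosSemidef.one).posDef_iff_isUnit.2
      (by rw [act_realignment_one]; exact isUnit_of_rank_eq hrank)
  have hpos : ∀ X : Matrix (Fin k) (Fin k) ℂ, X.PosSemidef →
      (act (realignment γ) X).PosSemidef := fun X hX => posSemidef_act_realignment hγ hX
  have hposT : ∀ X : Matrix (Fin k) (Fin k) ℂ, X.PosSemidef →
      (act (realignment (partialTranspose γ)) X).PosSemidef := fun X hX => by
    rw [act_realignment_partialTranspose]
    exact posSemidef_act_realignment hγ hX.transpose
  have hfam : ∀ (β : BipartiteMatrix k) (R : Matrix (Fin k) (Fin k) ℂ), β.IsHermitian →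
      (realignment β).PosSemidef →
      (∀ X : Matrix (Fin k) (Fin k) ℂ, X.PosSemidef → (act (realignment β) X).PosSemidef) →
      act (congr R (realignment β)) 1 = (1 / k : ℂ) • 1 →
      ∃ (n : ℕ) (lam : Fin (n + 1) → ℝ) (g : Fin (n + 1) → Matrix (Fin k) (Fin k) ℂ),
        IsFilterFamily lam g ∧
          congr R β = ∑ i, (lam i : ℂ) • (g i ⊗ₖ (g i).entrywiseConj) := by
    intro β R hβ hps hp h1
    have h := exists_filterFamily hk (posSemidef_congr hps R)
      (by rw [realignment_congr]; exact isHermitian_congr hβ R) (fun X hX => by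
        rw [act_congr]
        exact (hp _ (hX.mul_mul_conjTranspose_same R)).conjTranspose_mul_mul_same R) h1
    rwa [realignment_congr] at h
  -- If both realignments are positive they coincide, so one scaling serves both; if neither is,
  -- both claims are vacuous and `R = 1` will do.
  obtain ⟨R, hR, h1, h2⟩ : ∃ R : Matrix (Fin k) (Fin k) ℂ, IsUnit R ∧
      ((realignment (partialTranspose γ)).PosSemidef →
        act (congr R (realignment (partialTranspose γ))) 1 = (1 / k : ℂ) • 1) ∧
      ((realignment γ).PosSemidef → act (congr R (realignment γ)) 1 = (1 / k : ℂ) • 1) := by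
    by_cases hc : (realignment γ).PosSemidef
    · obtain ⟨R, hR, h⟩ := exists_congr_act_one hk hc hpos hM
      exact ⟨R, hR, fun hc' => by rwa [partialTranspose_eq_self hc hc'], fun _ => h⟩
    · by_cases hc' : (realignment (partialTranspose γ)).PosSemidef
      · obtain ⟨R, hR, h⟩ := exists_congr_act_one hk hc' hposT
          (by rwa [act_realignment_partialTranspose, transpose_one])
        exact ⟨R, hR, fun _ => h, fun h => absurd h hc⟩
      · exact ⟨1, isUnit_one, fun h => absurd h hc', fun h => absurd h hc⟩
  refine ⟨R, hR, fun hc => ⟨?_, ?_, ?_⟩, fun hc => ⟨?_, ?_, ?_, fun hinv => ⟨?_, ?_⟩⟩⟩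
  · obtain ⟨n, lam, g, hg, hsum⟩ := hfam _ R (isHermitian_partialTranspose hγ.isHermitian) hc
      hposT (h1 hc)
    refine ⟨n, lam, g, hg, ?_⟩
    have h3 := congrArg partialTranspose
      ((partialTranspose_kronecker_self_mul_mul_kronecker_self R γ).trans hsum)
    rw [partialTranspose_partialTranspose] at h3
    rw [h3]
    ext p q
    simp only [partialTranspose, of_apply, Matrix.sum_apply, Matrix.smul_apply,
      kroneckerMap_apply]
    refine Finset.sum_congr rfl fun i _ => ?_
    -- The transpose of the conjugate of the Hermitian `g i` is `g i` itself.
    rw [← (hg.isHermitian i).apply p.2 q.2]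
    rfl
  · have h := hγ.conjTranspose_mul_mul_same (R ⊗ₖ R)
    rwa [conjTranspose_kronecker] at h
  · rw [partialTranspose_kronecker_self_mul_mul_kronecker_self, realignment_congr]
    exact posSemidef_congr hc R
  · exact hfam γ R hγ.isHermitian hc hpos (h2 hc)
  · exact posSemidef_congr hγ R
  · exact (realignment_congr R γ).symm ▸ posSemidef_congr hc R
  · exact posSemidef_congr hγ R
  · exact (realignment_congr R γ).trans (by rw [hinv.2]; rfl)
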